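/- For a compact interval $[a,b]$ with $a<b$, a set $\Omega\subset[a,b]$ open in $[a,b]$ and integers $0\le\ell\le m$, let $\mathcal C^m_\Omega([a,b],\mathbb R^n)$ be the set of continuous maps $[a,b]\to\mathbb R^n$ that are of class $\mathcal C^m$ on $\Omega$. Its $\mathcal C^\ell_\Omega$-topology is the one generated by the sets of all $f$ with $\|f-g\|_{[a,b]}<\varepsilon$ and $\|f^{(k)}-g^{(k)}\|_K<\varepsilon$ for $k=1,\dots,\ell$, where $g\in\mathcal C^m_\Omega([a,b],\mathbb R^n)$, $K\subset\Omega$ is compact, $\varepsilon>0$, and $\|\cdot\|_T$ is the maximum over $T$ of the Euclidean norm. We write $h(u)=c\,u^k+\cdots$ if $h$ is, near $u=0$, the sum of a convergent power series with lowest order term $c\,u^k$, $c\neq0$. Let $S_0,\dots,S_r\subset\mathbb R^n$ be connected open semialgebraic sets (not necessarily pairwise different) and let $x_i\in\operatorname{Cl}(S_{i-1})\cap\operatorname{Cl}(S_i)$ for $i=1,\dots,r$. Let $a=t_0<t_1<\cdots<t_r<t_{r+1}=b$ and let $\beta:[a,b]\to\bigcup_{k=0}^rS_k\cup\{x_1,\dots,x_r\}$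 be a continuous path such that: (i) $\beta((t_k,t_{k+1}))\subset S_k$ for $k=0,\dots,r$, $\beta(a)\in S_0$ and $\beta(b)\in S_r$; (ii) $\beta(t_i)=x_i$ and $\beta$ is analytic on a neighborhood of $t_i$ for $i=1,\dots,r$; (iii) for $i=1,\dots,r$ there are polynomials $f_{i1},\dots,f_{is}\in\mathbb R[\mathtt x_1,\dots,\mathtt x_n]$ such that $\{f_{i1}>0,\dots,f_{is}>0\}\subset S_{i-1}$, this set has $x_i$ in its closure, and $(f_{ij}\circ\beta)(t_i-u)=a_{ij}u^{n_{ij}}+\cdots$ with $a_{ij}>0$ for $j=1,\dots,s$; (iv) for $i=1,\dots,r$ there are polynomials $g_{i1},\dots,g_{is}\in\mathbb R[\mathtt x_1,\dots,\mathtt x_n]$ such that $\{g_{i1}>0,\dots,g_{is}>0\}\subset S_i$, this set has $x_i$ in its closure, and $(g_{ij}\circ\beta)(t_i+u)=b_{ij}u^{p_{ij}}+\cdots$ with $b_{ij}>0$ for $j=1,\dots,s$. Let $\ell:=\max\{n_{ij},p_{ij}:1\le i\le r,\ 1\le j\le s\}$ (with $\max\varnothing=0$), and let $\Omega\subset[a,b]$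 be an open neighborhood of $\{t_1,\dots,t_r\}$ in $[a,b]$ such that $\beta|_\Omega$ is analytic. Then: (1) There is a neighborhood $\mathcal U$ of $\beta$ in $\mathcal C^{\ell+4}_\Omega([a,b],\mathbb R^n)$, open in the $\mathcal C^\ell_\Omega$-topology, such that if $\alpha\in\mathcal U$ and $\alpha^{(m)}(t_i)=\beta^{(m)}(t_i)$ for all $i=1,\dots,r$ and $m=0,\dots,\ell$, then $\alpha((t_k,t_{k+1}))\subset S_k$ for $k=0,\dots,r$. (2) Every neighborhood of $\beta$ in $\mathcal C^{\ell+4}_\Omega([a,b],\mathbb R^n)$ that is open in the $\mathcal C^\ell_\Omega$-topology contains a path $\alpha:[a,b]\to\bigcup_{k=0}^rS_k\cup\{x_1,\dots,x_r\}$ with polynomial components such that $\alpha(t_i)=x_i$ and $\alpha^{(m)}(t_i)=\beta^{(m)}(t_i)$ for $i=1,\dots,r$ and $m=0,\dots,\ell$, and $\alpha((t_k,t_{k+1}))\subset S_k$ for $k=0,\dots,r$. -/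

import Mathlib

open Set Topology

/-- Euclidean space `ℝⁿ`. -/
abbrev RSpace (n : ℕ) : Type := EuclideanSpace ℝ (Fin n)

/-- The value `p(y)` of a polynomial `p ∈ ℝ[x₁, …, xₙ]` at a point `y ∈ ℝⁿ`. -/
noncomputable def polyVal {n : ℕ} (p : MvPolynomial (Fin n) ℝ) (y : RSpace n) : ℝ :=
  MvPolynomial.eval (fun l => y l) p

/-- Semialgebraic subsets of `ℝⁿ`: the finite Boolean combinations of sets `{p > 0}` with `p`
a polynomial (the sets `{p = 0}` are among them, as complements of `{p > 0} ∪ {-p > 0}`). -/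
inductive IsSemialgebraic {n : ℕ} : Set (RSpace n) → Prop
  | pos (p : MvPolynomial (Fin n) ℝ) : IsSemialgebraic {y | 0 < polyVal p y}
  | union {A B : Set (RSpace n)} :
      IsSemialgebraic A → IsSemialgebraic B → IsSemialgebraic (A ∪ B)
  | compl {A : Set (RSpace n)} : IsSemialgebraic A → IsSemialgebraic Aᶜ

/-- The basic open semialgebraic set `{f₁ > 0, …, f_s > 0}`. -/
def basicOpenSet {n s : ℕ} (f : Fin s → MvPolynomial (Fin n) ℝ) : Set (RSpace n) :=
  {y | ∀ j, 0 < polyVal (f j) y}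

/-- `h(u) = c u^k + ⋯` near `u = 0`: the function `h` is the sum of a convergent power series
at `0` whose lowest order term is `c u^k`, with `c ≠ 0`. -/
def HasLowestTerm (h : ℝ → ℝ) (c : ℝ) (k : ℕ) : Prop :=
  c ≠ 0 ∧ ∃ q : FormalMultilinearSeries ℝ ℝ ℝ,
    HasFPowerSeriesAt h q 0 ∧ (∀ m < k, q.coeff m = 0) ∧ q.coeff k = c

/-- `Ω ⊆ [a,b]` is open in `[a,b]`. -/
def IsOpenInIcc (a b : ℝ) (Ω : Set ℝ) : Prop :=
  ∃ O : Set ℝ, IsOpen O ∧ Ω = O ∩ Icc a b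

/-- The space `C^m_Ω([a,b], ℝⁿ)` of continuous maps `[a,b] → ℝⁿ` that are of class `C^m` on `Ω`.
A map on `[a,b]` is given by a function on `ℝ`, whose values outside `[a,b]` play no role. -/
def pathSpace (n : ℕ) (a b : ℝ) (Ω : Set ℝ) (m : ℕ) : Set (ℝ → RSpace n) :=
  {f | ContinuousOn f (Icc a b) ∧ ContDiffOn ℝ m f Ω}

/-- The `k`-th derivative of a map on `[a,b]` (one-sided at the endpoints). -/
noncomputable def pathDeriv {n : ℕ} (a b : ℝ) (k : ℕ) (f : ℝ → RSpace n) : ℝ → RSpace n :=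
  iteratedDerivWithin k f (Icc a b)

/-- The set `U^ℓ_{g,K,ε}` of the `f` with `‖f - g‖_{[a,b]} < ε` and `‖f^(k) - g^(k)‖_K < ε` for
`k = 1, …, ℓ`, where `‖·‖_T` is the maximum of the Euclidean norm over the compact set `T`
(so that `‖h‖_T < ε` says that `‖h u‖ < ε` for all `u ∈ T`). -/
def basicNhd {n : ℕ} {a b : ℝ} {Ω : Set ℝ} {m : ℕ} (ℓ : ℕ) (g : pathSpace n a b Ω m)
    (K : Set ℝ) (ε : ℝ) : Set (pathSpace n a b Ω m) :=
  {f | (∀ u ∈ Icc a b, ‖f.1 u - g.1 u‖ < ε) ∧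
    ∀ k : ℕ, 1 ≤ k → k ≤ ℓ → ∀ u ∈ K, ‖pathDeriv a b k f.1 u - pathDeriv a b k g.1 u‖ < ε}

/-- The `C^ℓ_Ω`-topology on `C^m_Ω([a,b], ℝⁿ)` (used for `ℓ ≤ m`), generated by the sets
`U^ℓ_{g,K,ε}` with `K ⊆ Ω` compact and `ε > 0`. -/
abbrev pathTopology (n : ℕ) (a b : ℝ) (Ω : Set ℝ) (m ℓ : ℕ) :
    TopologicalSpace (pathSpace n a b Ω m) :=
  TopologicalSpace.generateFrom
    {U | ∃ (g : pathSpace n a b Ω m) (K : Set ℝ) (ε : ℝ),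
      IsCompact K ∧ K ⊆ Ω ∧ 0 < ε ∧ U = basicNhd ℓ g K ε}

/-- A polynomial path on `[a,b]`: all components are univariate polynomials. -/
def IsPolynomialPath {n : ℕ} (a b : ℝ) (f : ℝ → RSpace n) : Prop :=
  ∃ P : Fin n → Polynomial ℝ, ∀ u ∈ Icc a b, ∀ l, f u l = (P l).eval u

/-- A continuous map on `[a,b]` that is analytic on `Ω` is an element of every `C^m_Ω`. -/
theorem mem_pathSpace_of_analyticOn {n : ℕ} {a b : ℝ} {Ω : Set ℝ} {f : ℝ → RSpace n}
    (hf : ContinuousOn f (Icc a b)) (hab : a < b) (hΩ : IsOpenInIcc a b Ω)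
    (hfΩ : AnalyticOn ℝ f Ω) (m : ℕ) : f ∈ pathSpace n a b Ω m := by
  obtain ⟨O, hO, rfl⟩ := hΩ
  refine ⟨hf, hfΩ.contDiffOn ?_⟩
  rw [inter_comm]
  exact (uniqueDiffOn_Icc hab).inter hO

/-! Away from the nodes `t_i` the path lies in open sets, so uniform closeness to `β` suffices. At a
node, let `α` have the `ℓ`-jet of `β` and `ℓ`-th derivative within `ε` of that of `β`. Then `‖α(u) -
β(u)‖ ≤ ε |u - t_i|^ℓ` nearby (`norm_sub_le_of_mem_basicNhd`). Along `β` each defining polynomial is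
at least a positive multiple of `|u - t_i|^N` with `N ≤ ℓ`, and it is locally Lipschitz, so for
small `ε` it remains positive along `α` (`eventually_polyVal_pos_of_hasLowestTerm`). Compactness of
`[a,b]` merges these local statements into one basic neighbourhood (`exists_basicNhd_mapsTo`), which
is (1).

For (2), every open neighbourhood of `β` contains a basic one centred at `β`
(`exists_basicNhd_subset`). It then suffices to find a polynomial path in a small basic
neighbourhood with the exact jets at the nodes (`exists_polynomialPath_near_jets`): smooth `β` by a
cutoff, approximate by Weierstrass in `C^ℓ`, and correct the small jet errors by a Hermite
interpolant whose size is controlled by those errors. -/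

/-! ### Univariate polynomial approximation with interpolation of jets -/

theorem contDiff_eval_polynomial (p : Polynomial ℝ) {m : WithTop ℕ∞} :
    ContDiff ℝ m (fun v => p.eval v) := by
  simpa using p.contDiff_aeval (𝕜 := ℝ) m

theorem iteratedDerivWithin_eval_polynomial {S : Set ℝ} (hS : UniqueDiffOn ℝ S)
    (p : Polynomial ℝ) (k : ℕ) {u : ℝ} (hu : u ∈ S) :
    iteratedDerivWithin k (fun v => p.eval v) S u = (Polynomial.derivative^[k] p).eval u := by
  rw [iteratedDerivWithin_eq_iteratedDeriv hS (contDiff_eval_polynomial p).contDiffAt hu, iteratedDeriv_eq_iterate]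
  clear hu
  induction k generalizing p with
  | zero => rfl
  | succ k ih =>
    rw [Function.iterate_succ_apply, Function.iterate_succ_apply, ← ih]
    have : deriv (fun v => p.eval v) = fun v => (Polynomial.derivative p).eval v :=
      funext fun v => p.deriv
    rw [this]

/-- Every real polynomial has an antiderivative with prescribed value at a point. -/
theorem exists_derivative_eq (q : Polynomial ℝ) (a y : ℝ) :
    ∃ p : Polynomial ℝ, Polynomial.derivative p = q ∧ p.eval a = y := by
  have key : ∃ p : Polynomial ℝ, Polynomial.derivative p = q := by
    induction q using Polynomial.induction_on' with
    | add q₁ q₂ h₁ h₂ =>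
      obtain ⟨p₁, rfl⟩ := h₁
      obtain ⟨p₂, rfl⟩ := h₂
      exact ⟨p₁ + p₂, by simp⟩
    | monomial m c =>
      refine ⟨Polynomial.monomial (m + 1) (c / (m + 1)), ?_⟩
      rw [Polynomial.derivative_monomial]
      congr 1
      have : (m : ℝ) + 1 ≠ 0 := by positivity
      push_cast
      field_simp
  obtain ⟨p, rfl⟩ := key
  exact ⟨p + Polynomial.C (y - p.eval a), by simp, by simp⟩

/-- Polynomials are dense in `C^ℓ([a,b])`. -/
theorem exists_polynomial_near_of_contDiffOn {a b : ℝ} (hab : a < b) (ℓ : ℕ) {f : ℝ → ℝ}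
    (hf : ContDiffOn ℝ ℓ f (Icc a b)) {ε : ℝ} (hε : 0 < ε) :
    ∃ p : Polynomial ℝ, ∀ k ≤ ℓ, ∀ u ∈ Icc a b,
      |(Polynomial.derivative^[k] p).eval u - iteratedDerivWithin k f (Icc a b) u| < ε := by
  induction ℓ generalizing f ε with
  | zero =>
    obtain ⟨p, hp⟩ := exists_polynomial_near_of_continuousOn a b f hf.continuousOn ε hε
    refine ⟨p, fun k hk u hu => ?_⟩
    obtain rfl : k = 0 := by omega
    simpa using hp u hu
  | succ ℓ ih =>
    have hU : UniqueDiffOn ℝ (Icc a b) := uniqueDiffOn_Icc hab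
    have hd : DifferentiableOn ℝ f (Icc a b) := hf.differentiableOn (by simp)
    have hf' : ContDiffOn ℝ ℓ (derivWithin f (Icc a b)) (Icc a b) :=
      hf.derivWithin hU (by norm_cast)
    -- Integrating from `a` multiplies the error by at most `b - a`; the extra `1` keeps the
    -- inequality strict.
    have hδ : 0 < min ε (ε / (b - a + 1)) := lt_min hε (div_pos hε (by linarith))
    obtain ⟨q, hq⟩ := ih hf' hδ
    obtain ⟨p, hpq, hpa⟩ := exists_derivative_eq q a (f a)
    have haI : a ∈ Icc a b := left_mem_Icc.2 hab.le
    refine ⟨p, fun k hk u hu => ?_⟩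
    cases k with
    | zero =>
      have hbd : ∀ v ∈ Icc a b,
          ‖derivWithin (fun w => p.eval w - f w) (Icc a b) v‖ ≤ ε / (b - a + 1) := by
        intro v hv
        rw [derivWithin_fun_sub p.differentiableAt.differentiableWithinAt (hd v hv),
          p.derivWithin (hU v hv), hpq]
        have := hq 0 (Nat.zero_le _) v hv
        simp only [Function.iterate_zero, id, iteratedDerivWithin_zero] at this
        exact (this.trans_le (min_le_right _ _)).le
      have h := (convex_Icc a b).norm_image_sub_le_of_norm_derivWithin_le
        (p.differentiable.differentiableOn.sub hd) hbd haI hu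
      simp only [Pi.sub_apply, hpa, sub_self, sub_zero, Real.norm_eq_abs] at h
      simp only [Function.iterate_zero, id, iteratedDerivWithin_zero]
      refine h.trans_lt ?_
      rw [abs_of_nonneg (by linarith [hu.1]), div_mul_eq_mul_div,
        div_lt_iff₀ (by linarith [hu.1])]
      nlinarith [hu.2]
    | succ k =>
      rw [Function.iterate_succ_apply, hpq, iteratedDerivWithin_succ']
      exact (hq k (by omega) u hu).trans_le (min_le_left _ _)

/-- Hermite interpolation: polynomials with prescribed jets at finitely many points. -/
theorem exists_polynomial_jets {ι : Type*} [Fintype ι] {τ : ι → ℝ} (hτ : Function.Injective τ)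
    (M : ℕ) (d : ι → ℕ → ℝ) :
    ∃ p : Polynomial ℝ, ∀ i, ∀ m < M, (Polynomial.derivative^[m] p).eval (τ i) = d i m := by
  classical
  induction M with
  | zero => exact ⟨0, fun i m hm => absurd hm (Nat.not_lt_zero _)⟩
  | succ M ih =>
    obtain ⟨p, hp⟩ := ih
    -- With `e i = (X - τ i)^M * w i` below, `e i` vanishes to order exactly `M` at `τ i` and to
    -- order at least `M + 1` at the other nodes. Adding multiples of the `e i` therefore adjusts
    -- the `M`-th derivatives one node at a time and leaves all lower jets unchanged.
    let w : ι → Polynomial ℝ := fun i =>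
      ∏ j ∈ Finset.univ.erase i, (Polynomial.X - Polynomial.C (τ j)) ^ (M + 1)
    have hw : ∀ i, (w i).eval (τ i) ≠ 0 := by
      intro i
      rw [Polynomial.eval_prod, Finset.prod_ne_zero_iff]
      intro j hj
      simpa [sub_eq_zero] using fun h => (Finset.ne_of_mem_erase hj) (hτ h).symm
    have hvan : ∀ (c : ℝ) (k m : ℕ) (q : Polynomial ℝ),
        (Polynomial.X - Polynomial.C c) ^ k ∣ q → m < k →
        (Polynomial.derivative^[m] q).eval c = 0 := by
      intro c k m q hq hm
      have h := Polynomial.pow_sub_dvd_iterate_derivative_of_pow_dvd m hq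
      have h' := (dvd_pow_self (Polynomial.X - Polynomial.C c) (by omega : k - m ≠ 0)).trans h
      exact Polynomial.dvd_iff_isRoot.1 h'
    let e : ι → Polynomial ℝ := fun i => (Polynomial.X - Polynomial.C (τ i)) ^ M * w i
    have he : ∀ i, (Polynomial.derivative^[M] (e i)).eval (τ i) ≠ 0 := by
      intro i h
      have hdvd : (Polynomial.X - Polynomial.C (τ i)) ^ (M + 1) ∣ e i := by
        have hne : e i ≠ 0 := mul_ne_zero (pow_ne_zero _ (Polynomial.X_sub_C_ne_zero _))
          fun h0 => hw i (by rw [h0, Polynomial.eval_zero])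
        refine (Polynomial.le_rootMultiplicity_iff hne).1
          (Polynomial.lt_rootMultiplicity_of_isRoot_iterate_derivative hne fun m hm => ?_)
        rcases hm.lt_or_eq with hm | rfl
        · exact hvan _ M m _ (dvd_mul_right _ _) hm
        · exact h
      rw [pow_succ] at hdvd
      have := (mul_dvd_mul_iff_left (pow_ne_zero M (Polynomial.X_sub_C_ne_zero (τ i)))).1 hdvd
      exact hw i (Polynomial.dvd_iff_isRoot.1 this)
    have heother : ∀ i j m, m < M + 1 → i ≠ j → (Polynomial.derivative^[m] (e j)).eval (τ i) = 0 := by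
      intro i j m hm hij
      refine hvan _ (M + 1) m _ (Dvd.dvd.mul_left ?_ _) hm
      exact Finset.dvd_prod_of_mem (fun j => (Polynomial.X - Polynomial.C (τ j)) ^ (M + 1))
        (Finset.mem_erase.2 ⟨hij, Finset.mem_univ i⟩)
    let c : ι → ℝ := fun i => (d i M - (Polynomial.derivative^[M] p).eval (τ i)) /
      (Polynomial.derivative^[M] (e i)).eval (τ i)
    refine ⟨p + ∑ j, Polynomial.C (c j) * e j, fun i m hm => ?_⟩
    rw [iterate_map_add, Polynomial.eval_add, Polynomial.iterate_derivative_sum,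
      Polynomial.eval_finsetSum, Finset.sum_eq_single i]
    · rw [Polynomial.iterate_derivative_C_mul, Polynomial.eval_mul, Polynomial.eval_C]
      rcases Nat.lt_succ_iff_lt_or_eq.1 hm with hm | rfl
      · rw [hp i m hm, hvan (τ i) M m (e i) (dvd_mul_right _ _) hm, mul_zero, add_zero]
      · simp only [c]
        rw [div_mul_cancel₀ _ (he i)]
        ring
    · intro j _ hj
      rw [Polynomial.iterate_derivative_C_mul, Polynomial.eval_mul, heother i j m hm hj.symm,
        mul_zero]
    · simp

/-- Hermite interpolation with control of the interpolating polynomial by the data. -/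
theorem exists_bound_polynomial_jets {ι : Type*} [Fintype ι] {τ : ι → ℝ}
    (hτ : Function.Injective τ) (ℓ : ℕ) (a b : ℝ) :
    ∃ C : ℝ, 0 < C ∧ ∀ (d : ι → ℕ → ℝ) (δ : ℝ), 0 ≤ δ → (∀ i, ∀ m ≤ ℓ, |d i m| ≤ δ) →
      ∃ p : Polynomial ℝ,
        (∀ i, ∀ m ≤ ℓ, (Polynomial.derivative^[m] p).eval (τ i) = d i m) ∧
        ∀ k ≤ ℓ, ∀ u ∈ Icc a b, |(Polynomial.derivative^[k] p).eval u| ≤ C * δ := by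
  classical
  -- The `e jm` form a dual basis for the jet functionals, so the interpolant is linear in the data
  -- and its bound depends only on the sup norms of their derivatives.
  choose e he using fun jm : ι × Fin (ℓ + 1) => exists_polynomial_jets hτ (ℓ + 1)
    (fun i m => if i = jm.1 ∧ m = jm.2 then 1 else 0)
  have hb : ∀ x : (ι × Fin (ℓ + 1)) × Fin (ℓ + 1), ∃ B : ℝ, ∀ u ∈ Icc a b,
      |(Polynomial.derivative^[x.2] (e x.1)).eval u| ≤ B := fun x =>
    isCompact_Icc.exists_bound_of_continuousOn (Polynomial.continuous _).continuousOn
  choose B hB using hb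
  let C : ℝ := ∑ x, |B x|
  refine ⟨C + 1, by positivity, fun d δ hδ hd => ?_⟩
  refine ⟨∑ jm : ι × Fin (ℓ + 1), Polynomial.C (d jm.1 jm.2) * e jm, fun i m hm => ?_,
    fun k hk u hu => ?_⟩
  · rw [Polynomial.iterate_derivative_sum, Polynomial.eval_finsetSum,
      Finset.sum_eq_single (i, (⟨m, by omega⟩ : Fin (ℓ + 1)))]
    · rw [Polynomial.iterate_derivative_C_mul, Polynomial.eval_mul, he _ i m (by omega)]
      simp
    · rintro ⟨j, m'⟩ _ hne
      rw [Polynomial.iterate_derivative_C_mul, Polynomial.eval_mul, he _ i m (by omega), if_neg,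
        mul_zero]
      rintro ⟨rfl, rfl⟩
      exact hne rfl
    · simp
  · rw [Polynomial.iterate_derivative_sum, Polynomial.eval_finsetSum]
    have hkk : ∑ jm : ι × Fin (ℓ + 1), |B (jm, ⟨k, by omega⟩)| ≤ C := by
      rw [← Finset.sum_image (f := fun x => |B x|)
        (g := fun jm : ι × Fin (ℓ + 1) => (jm, (⟨k, by omega⟩ : Fin (ℓ + 1))))]
      · exact Finset.sum_le_sum_of_subset_of_nonneg (Finset.subset_univ _) fun _ _ _ => abs_nonneg _
      · intro x _ y _ h
        exact congrArg Prod.fst h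
    calc |∑ jm : ι × Fin (ℓ + 1),
          (Polynomial.derivative^[k] (Polynomial.C (d jm.1 jm.2) * e jm)).eval u|
        ≤ ∑ jm : ι × Fin (ℓ + 1), |B (jm, ⟨k, by omega⟩)| * δ := by
          refine (Finset.abs_sum_le_sum_abs _ _).trans (Finset.sum_le_sum fun jm _ => ?_)
          rw [Polynomial.iterate_derivative_C_mul, Polynomial.eval_mul, Polynomial.eval_C, abs_mul,
            mul_comm]
          exact mul_le_mul ((hB (jm, ⟨k, by omega⟩) u hu).trans (le_abs_self _))
            (hd _ _ (by omega)) (abs_nonneg _) (abs_nonneg _)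
      _ ≤ (C + 1) * δ := by
          rw [← Finset.sum_mul]
          exact mul_le_mul_of_nonneg_right (by linarith) hδ

/-- A continuous function on `[a,b]` that is of class `C^ℓ` on a relatively open set is uniformly
close to a function of class `C^ℓ` on `[a,b]` that agrees with it near a given compact set. -/
theorem exists_contDiffOn_near_eventuallyEq {a b : ℝ} {ℓ : ℕ} {O : Set ℝ} (hO : IsOpen O)
    {f : ℝ → ℝ} (hf : ContinuousOn f (Icc a b)) (hfO : ContDiffOn ℝ ℓ f (O ∩ Icc a b))
    {K : Set ℝ} (hK : IsCompact K) (hKO : K ⊆ O) {ε : ℝ} (hε : 0 < ε) :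
    ∃ γ : ℝ → ℝ, ContDiffOn ℝ ℓ γ (Icc a b) ∧ (∀ u ∈ Icc a b, |γ u - f u| < ε) ∧
      ∀ u ∈ K, γ =ᶠ[𝓝 u] f := by
  -- The cutoff `χ` is `1` near `K` and `0` near the complement of `O`; the blend of `f` with a
  -- uniformly close polynomial is that polynomial wherever `f` may fail to be smooth.
  obtain ⟨χ, hχ0, hχ1, hχ⟩ := exists_contMDiffMap_zero_one_nhds_of_isClosed
    (n := (ℓ : ℕ∞)) (modelWithCornersSelf ℝ ℝ) hO.isClosed_compl hK.isClosed
    (disjoint_compl_left_iff_subset.2 hKO)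
  have hχs : ContDiff ℝ ℓ χ := χ.contMDiff.contDiff
  obtain ⟨p, hp⟩ := exists_polynomial_near_of_continuousOn a b f hf ε hε
  have hpc : ContDiff ℝ ℓ (fun v => p.eval v) := contDiff_eval_polynomial p
  refine ⟨fun u => χ u * f u + (1 - χ u) * p.eval u, fun u hu => ?_, fun u hu => ?_,
    fun u hu => ?_⟩
  · by_cases huO : u ∈ O
    · have h : ContDiffWithinAt ℝ ℓ f (Icc a b) u :=
        (contDiffWithinAt_inter (hO.mem_nhds huO)).1 (inter_comm O _ ▸ hfO u ⟨huO, hu⟩)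
      exact (hχs.contDiffWithinAt.mul h).add
        ((contDiffWithinAt_const.sub hχs.contDiffWithinAt).mul hpc.contDiffWithinAt)
    · refine ContDiffAt.contDiffWithinAt (hpc.contDiffAt.congr_of_eventuallyEq ?_)
      filter_upwards [Filter.Eventually.filter_mono (nhds_le_nhdsSet huO) hχ0] with v hv
      simp [hv]
  · have : χ u * f u + (1 - χ u) * p.eval u - f u = (1 - χ u) * (p.eval u - f u) := by ring
    rw [this, abs_mul, abs_of_nonneg (by linarith [(hχ u).2])]
    have h1 := hp u hu
    have h2 := (hχ u).1
    have h3 := (hχ u).2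
    calc (1 - χ u) * |p.eval u - f u| ≤ 1 * |p.eval u - f u| :=
          mul_le_mul_of_nonneg_right (by linarith) (abs_nonneg _)
      _ < ε := by rwa [one_mul]
  · filter_upwards [Filter.Eventually.filter_mono (nhds_le_nhdsSet hu) hχ1] with v hv
    simp [hv]

/-- Polynomial approximation, uniform on `[a,b]` and `C^ℓ` on a compact subset of the locus of
smoothness, with interpolation of the `ℓ`-jets at finitely many points of this locus. -/
theorem exists_polynomial_near_jets {ι : Type*} [Fintype ι] {τ : ι → ℝ}
    (hτ : Function.Injective τ) {a b : ℝ} (hab : a < b) {ℓ : ℕ} {O : Set ℝ} (hO : IsOpen O)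
    {f : ℝ → ℝ} (hf : ContinuousOn f (Icc a b)) (hfO : ContDiffOn ℝ ℓ f (O ∩ Icc a b))
    (hτO : ∀ i, τ i ∈ O ∩ Icc a b)
    {K : Set ℝ} (hK : IsCompact K) (hKO : K ⊆ O ∩ Icc a b) {ε : ℝ} (hε : 0 < ε) :
    ∃ p : Polynomial ℝ, (∀ u ∈ Icc a b, |p.eval u - f u| < ε) ∧
      (∀ k ≤ ℓ, ∀ u ∈ K,
        |(Polynomial.derivative^[k] p).eval u - iteratedDerivWithin k f (Icc a b) u| < ε) ∧
      ∀ i, ∀ m ≤ ℓ,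
        (Polynomial.derivative^[m] p).eval (τ i) = iteratedDerivWithin m f (Icc a b) (τ i) := by
  obtain ⟨C, hC, hH⟩ := exists_bound_polynomial_jets hτ ℓ a b
  obtain ⟨γ, hγ, hγf, hγK⟩ := exists_contDiffOn_near_eventuallyEq hO hf hfO
    (hK.union (finite_range τ).isCompact)
    (union_subset (hKO.trans inter_subset_left) (range_subset_iff.2 fun i => (hτO i).1))
    (half_pos hε)
  have hD : ∀ u ∈ (K ∪ range τ), ∀ k,
      iteratedDerivWithin k γ (Icc a b) u = iteratedDerivWithin k f (Icc a b) u := fun u hu k =>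
    ((hγK u hu).filter_mono nhdsWithin_le_nhds).iteratedDerivWithin_eq (hγK u hu).eq_of_nhds
  -- The approximation costs `δ` and the jet correction at most `C * δ`, in total `ε / 2`; the other
  -- half pays for replacing `f` by `γ`.
  have hδ : 0 < ε / 2 / (C + 1) := by positivity
  obtain ⟨q, hq⟩ := exists_polynomial_near_of_contDiffOn hab ℓ hγ hδ
  obtain ⟨h, hh, hhb⟩ := hH
    (fun i m => iteratedDerivWithin m γ (Icc a b) (τ i) - (Polynomial.derivative^[m] q).eval (τ i))
    _ hδ.le fun i m hm => by
      rw [abs_sub_comm]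
      exact (hq m hm (τ i) (hτO i).2).le
  have hev : ∀ k u, (Polynomial.derivative^[k] (q + h)).eval u =
      (Polynomial.derivative^[k] q).eval u + (Polynomial.derivative^[k] h).eval u := fun k u => by
    rw [iterate_map_add, Polynomial.eval_add]
  have hclose : ∀ k ≤ ℓ, ∀ u ∈ Icc a b, |(Polynomial.derivative^[k] (q + h)).eval u -
      iteratedDerivWithin k γ (Icc a b) u| < ε / 2 := by
    intro k hk u hu
    rw [hev, add_sub_right_comm]
    refine (abs_add_le _ _).trans_lt
      ((add_lt_add_of_lt_of_le (hq k hk u hu) (hhb k hk u hu)).trans_eq ?_)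
    field_simp
    ring
  refine ⟨q + h, fun u hu => ?_, fun k hk u hu => ?_, fun i m hm => ?_⟩
  · have h1 := hclose 0 (Nat.zero_le _) u hu
    simp only [Function.iterate_zero, id, iteratedDerivWithin_zero] at h1
    have := abs_sub_le ((q + h).eval u) (γ u) (f u)
    linarith [hγf u hu]
  · rw [← hD u (Or.inl hu)]
    linarith [hclose k hk u (hKO hu).2]
  · rw [hev, hh i m hm, ← hD _ (Or.inr (mem_range_self i))]
    ring

/-! ### Taylor bounds and persistence of polynomial inequalities at a node -/

/-- A map with vanishing jet of order `ℓ - 1` at `τ` and `ℓ`-th derivative bounded by `ε` is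
bounded by `ε |u - τ| ^ ℓ`. -/
theorem norm_le_mul_abs_pow_of_iteratedDeriv {E : Type*} [NormedAddCommGroup E] [NormedSpace ℝ E]
    {ℓ : ℕ} {φ : ℝ → E} {τ δ ε : ℝ} (hφ : ∀ u ∈ Metric.ball τ δ, ContDiffAt ℝ ℓ φ u)
    (h0 : ∀ m < ℓ, iteratedDeriv m φ τ = 0)
    (hb : ∀ u ∈ Metric.ball τ δ, ‖iteratedDeriv ℓ φ u‖ ≤ ε) :
    ∀ u ∈ Metric.ball τ δ, ‖φ u‖ ≤ ε * |u - τ| ^ ℓ := by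
  induction ℓ generalizing φ with
  | zero => simpa using hb
  | succ ℓ ih =>
    intro u hu
    have hδ : 0 < δ := Metric.pos_of_mem_ball hu
    have hε : 0 ≤ ε := (norm_nonneg _).trans (hb u hu)
    have hd : ∀ v ∈ Metric.ball τ δ, ‖deriv φ v‖ ≤ ε * |v - τ| ^ ℓ := by
      refine ih (fun v hv => ?_) (fun m hm => ?_) fun v hv => ?_
      · exact ((hφ v hv).fderiv_right (m := ℓ) (by norm_cast)).clm_apply contDiffAt_const
      · rw [← iteratedDeriv_succ']
        exact h0 _ (by omega)
      · rw [← iteratedDeriv_succ']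
        exact hb v hv
    have hφ0 : φ τ = 0 := by simpa using h0 0 (by omega)
    have hsub : ∀ v ∈ segment ℝ τ u, v ∈ Metric.ball τ δ := fun v hv =>
      (convex_ball τ δ).segment_subset (Metric.mem_ball_self hδ) hu hv
    -- Mean value inequality on the segment from `τ` to `u`, where `|v - τ| ≤ |u - τ|`.
    have h := (convex_segment τ u).norm_image_sub_le_of_norm_deriv_le (f := φ)
      (C := ε * |u - τ| ^ ℓ) (fun v hv => (hφ v (hsub v hv)).differentiableAt (by simp))
      (fun v hv => (hd v (hsub v hv)).trans ?_) (left_mem_segment ℝ τ u) (right_mem_segment ℝ τ u)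
    · rw [hφ0, sub_zero, Real.norm_eq_abs] at h
      rwa [pow_succ, ← mul_assoc]
    · rw [segment_eq_uIcc] at hv
      exact mul_le_mul_of_nonneg_left
        (pow_le_pow_left₀ (abs_nonneg _) (abs_sub_left_of_mem_uIcc hv) _) hε

theorem contDiff_polyVal {n : ℕ} (p : MvPolynomial (Fin n) ℝ) {m : WithTop ℕ∞} :
    ContDiff ℝ m (polyVal p) := by
  unfold polyVal
  induction p using MvPolynomial.induction_on with
  | C c => simpa using contDiff_const
  | add p q hp hq => simpa using hp.add hq
  | mul_X p i hp =>
    simp only [map_mul, MvPolynomial.eval_X]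
    exact hp.mul (EuclideanSpace.proj (𝕜 := ℝ) i).contDiff

/-- If the lowest term of `p ∘ γ` has positive coefficient and order at most `ℓ`, then `p` is
positive at all points `y` with `‖y - γ v‖ ≤ ε v ^ ℓ`, for small `ε` and small `v > 0`. -/
theorem eventually_polyVal_pos_of_hasLowestTerm {n : ℕ} {p : MvPolynomial (Fin n) ℝ}
    {γ : ℝ → RSpace n} (hγ : ContinuousAt γ 0) {c : ℝ} (hc : 0 < c) {N ℓ : ℕ} (hN : N ≤ ℓ)
    (h : HasLowestTerm (fun v => polyVal p (γ v)) c N) :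
    ∀ᶠ ε in 𝓝[>] (0 : ℝ), ∀ᶠ v in 𝓝[>] (0 : ℝ), ∀ y, ‖y - γ v‖ ≤ ε * v ^ ℓ → 0 < polyVal p y := by
  obtain ⟨-, q, hq, hq0, hqN⟩ := h
  obtain ⟨L, T, hT, hL⟩ := ((contDiff_polyVal p (m := 1)).contDiffAt (x := γ 0)).exists_lipschitzOnWith
  obtain ⟨ρ, hρ, hρT⟩ := Metric.mem_nhds_iff.1 hT
  -- The remainder after `c * v ^ N` is at most `M * v * v ^ N`, hence below half the leading term
  -- once `M * v < c / 2`.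
  have hlow : ∀ᶠ v in 𝓝[>] (0 : ℝ), c / 2 * v ^ N ≤ polyVal p (γ v) := by
    have hO := hq.isBigO_sub_partialSum_pow (N + 1)
    have hps : ∀ v : ℝ, q.partialSum (N + 1) v = c * v ^ N := by
      intro v
      rw [FormalMultilinearSeries.partialSum, Finset.sum_range_succ, Finset.sum_eq_zero]
      · simp [hqN, mul_comm]
      · intro m hm
        simp [hq0 m (Finset.mem_range.1 hm)]
    obtain ⟨M, hM0, hM⟩ := hO.exists_pos
    have hsmall : ∀ᶠ v in 𝓝[>] (0 : ℝ), M * v < c / 2 := by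
      have : Filter.Tendsto (fun v : ℝ => M * v) (𝓝 0) (𝓝 (M * 0)) :=
        (continuous_const.mul continuous_id).tendsto 0
      rw [mul_zero] at this
      exact (this.eventually_lt_const (half_pos hc)).filter_mono nhdsWithin_le_nhds
    filter_upwards [hsmall, self_mem_nhdsWithin, hM.bound.filter_mono nhdsWithin_le_nhds]
      with v hv1 hv0 hv
    have hv0 : 0 < v := hv0
    rw [hps, zero_add, norm_pow, norm_norm, Real.norm_eq_abs, Real.norm_eq_abs, abs_of_pos hv0,
      pow_succ] at hv
    have h1 := (abs_le.1 hv).1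
    have h2 : 0 < v ^ N := pow_pos hv0 N
    nlinarith
  -- The first bound makes the Lipschitz loss `L * ε * v ^ N` smaller than `c / 2 * v ^ N`; the
  -- second keeps `y` in the ball where the Lipschitz bound is valid.
  have hε : ∀ᶠ ε in 𝓝[>] (0 : ℝ), L * ε < c / 2 ∧ ε < ρ / 2 := by
    have : Filter.Tendsto (fun v : ℝ => (L : ℝ) * v) (𝓝 0) (𝓝 (L * 0)) :=
      (continuous_const.mul continuous_id).tendsto 0
    rw [mul_zero] at this
    exact ((this.eventually_lt_const (half_pos hc)).and
      (eventually_lt_nhds (half_pos hρ))).filter_mono nhdsWithin_le_nhds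
  filter_upwards [hε, self_mem_nhdsWithin] with ε ⟨hε1, hε2⟩ hε0
  have hε0 : 0 < ε := hε0
  have hv1 : ∀ᶠ v in 𝓝[>] (0 : ℝ), v < 1 :=
    (eventually_lt_nhds one_pos).filter_mono nhdsWithin_le_nhds
  have hγρ : ∀ᶠ v in 𝓝[>] (0 : ℝ), dist (γ v) (γ 0) < ρ / 2 :=
    (Metric.continuousAt_iff'.1 hγ _ (half_pos hρ)).filter_mono nhdsWithin_le_nhds
  filter_upwards [hlow, hv1, hγρ, self_mem_nhdsWithin] with v hlow hv1 hγρ hv0 y hy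
  have hv0 : 0 < v := hv0
  have hpow : v ^ ℓ ≤ v ^ N := pow_le_pow_of_le_one hv0.le hv1.le hN
  have hpow1 : v ^ ℓ ≤ 1 := pow_le_one₀ hv0.le hv1.le
  have hyd : dist y (γ v) < ρ / 2 := by
    rw [dist_eq_norm]
    nlinarith
  have hyT : y ∈ T := hρT (by
    rw [Metric.mem_ball]
    linarith [dist_triangle y (γ v) (γ 0)])
  have hγT : γ v ∈ T := hρT (by
    rw [Metric.mem_ball]
    linarith)
  have hLip := hL.dist_le_mul y hyT _ hγT
  rw [Real.dist_eq, dist_eq_norm] at hLip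
  have h1 := (abs_le.1 hLip).1
  have h2 : (L : ℝ) * ‖y - γ v‖ ≤ L * (ε * v ^ N) :=
    mul_le_mul_of_nonneg_left (hy.trans (mul_le_mul_of_nonneg_left hpow hε0.le)) L.2
  have h3 : 0 < v ^ N := pow_pos hv0 N
  nlinarith

/-! ### The path space and its basic neighbourhoods -/

theorem contDiffWithinAt_of_mem_pathSpace {n : ℕ} {a b : ℝ} {Ω : Set ℝ} {m : ℕ}
    (hΩ : IsOpenInIcc a b Ω) {f : ℝ → RSpace n} (hf : f ∈ pathSpace n a b Ω m) {u : ℝ}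
    (hu : u ∈ Ω) {k : ℕ} (hk : k ≤ m) : ContDiffWithinAt ℝ k f (Icc a b) u := by
  obtain ⟨O, hO, rfl⟩ := hΩ
  refine (contDiffWithinAt_inter (hO.mem_nhds hu.1)).1 ?_
  rw [inter_comm]
  exact (hf.2 u hu).of_le (by exact_mod_cast hk)

theorem IsOpenInIcc.subset {a b : ℝ} {Ω : Set ℝ} (hΩ : IsOpenInIcc a b Ω) : Ω ⊆ Icc a b := by
  obtain ⟨O, -, rfl⟩ := hΩ
  exact inter_subset_right

theorem continuousOn_pathDeriv {n : ℕ} {a b : ℝ} (hab : a < b) {Ω : Set ℝ} {m : ℕ}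
    (hΩ : IsOpenInIcc a b Ω) {f : ℝ → RSpace n} (hf : f ∈ pathSpace n a b Ω m) {k : ℕ}
    (hk : k ≤ m) : ContinuousOn (pathDeriv a b k f) Ω := by
  have hfΩ := hf.2
  obtain ⟨O, hO, rfl⟩ := hΩ
  have hU : UniqueDiffOn ℝ (O ∩ Icc a b) := by
    rw [inter_comm]
    exact (uniqueDiffOn_Icc hab).inter hO
  refine (hfΩ.continuousOn_iteratedDerivWithin (by exact_mod_cast hk) hU).congr fun u hu => ?_
  rw [pathDeriv, iteratedDerivWithin, iteratedDerivWithin, inter_comm,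
    iteratedFDerivWithin_inter_open hO hu.1]

theorem pathDeriv_apply {n : ℕ} {a b : ℝ} (hab : a < b) {k : ℕ} {φ : ℝ → RSpace n} {u : ℝ}
    (hu : u ∈ Icc a b) (hφ : ContDiffWithinAt ℝ k φ (Icc a b) u) (l : Fin n) :
    pathDeriv a b k φ u l = iteratedDerivWithin k (fun v => φ v l) (Icc a b) u := by
  have h := (EuclideanSpace.proj (𝕜 := ℝ) l).iteratedFDerivWithin_comp_left hφ
    (uniqueDiffOn_Icc hab) hu le_rfl
  exact (DFunLike.congr_fun h fun _ => (1 : ℝ)).symm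

theorem EuclideanSpace.norm_lt_of_forall_abs_lt {n : ℕ} {v : RSpace n} {ε : ℝ} (hε : 0 < ε)
    (h : ∀ l, |v l| < ε / (n + 1)) : ‖v‖ < ε := by
  rw [EuclideanSpace.norm_eq, Real.sqrt_lt' hε]
  have h1 : ∑ l, ‖v l‖ ^ 2 ≤ ∑ _l : Fin n, (ε / (n + 1)) ^ 2 :=
    Finset.sum_le_sum fun l _ => pow_le_pow_left₀ (norm_nonneg _) (h l).le 2
  refine h1.trans_lt ?_
  rw [Finset.sum_const, Finset.card_univ, Fintype.card_fin, nsmul_eq_mul, div_pow, mul_div_assoc',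
    div_lt_iff₀ (by positivity)]
  have : (n : ℝ) < (n + 1) ^ 2 := by nlinarith [n.cast_nonneg (α := ℝ)]
  rw [mul_comm]
  exact mul_lt_mul_of_pos_left this (by positivity)

/-- The path whose components are given polynomials. -/
noncomputable def polynomialPath {n : ℕ} (P : Fin n → Polynomial ℝ) (u : ℝ) : RSpace n :=
  WithLp.toLp 2 fun l => (P l).eval u

theorem contDiff_polynomialPath {n : ℕ} (P : Fin n → Polynomial ℝ) {m : WithTop ℕ∞} :
    ContDiff ℝ m (polynomialPath P) :=
  contDiff_euclidean.2 fun l => contDiff_eval_polynomial (P l)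

theorem pathDeriv_polynomialPath {n : ℕ} {a b : ℝ} (hab : a < b) (P : Fin n → Polynomial ℝ)
    (k : ℕ) {u : ℝ} (hu : u ∈ Icc a b) (l : Fin n) :
    pathDeriv a b k (polynomialPath P) u l = (Polynomial.derivative^[k] (P l)).eval u := by
  rw [pathDeriv_apply hab hu (contDiff_polynomialPath P).contDiffWithinAt]
  exact iteratedDerivWithin_eval_polynomial (uniqueDiffOn_Icc hab) (P l) k hu

theorem exists_polynomialPath_near_jets {n : ℕ} {ι : Type*} [Fintype ι] {τ : ι → ℝ}
    (hτ : Function.Injective τ) {a b : ℝ} (hab : a < b) {ℓ m : ℕ} (hm : ℓ ≤ m) {Ω : Set ℝ}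
    (hΩ : IsOpenInIcc a b Ω) (hτΩ : ∀ i, τ i ∈ Ω) (β : pathSpace n a b Ω m)
    {K : Set ℝ} (hK : IsCompact K) (hKΩ : K ⊆ Ω) {ε : ℝ} (hε : 0 < ε) :
    ∃ α ∈ basicNhd ℓ β K ε, IsPolynomialPath a b α.1 ∧
      ∀ i, ∀ k ≤ ℓ, pathDeriv a b k α.1 (τ i) = pathDeriv a b k β.1 (τ i) := by
  have hcd : ∀ u ∈ Ω, ∀ k ≤ ℓ, ContDiffWithinAt ℝ k β.1 (Icc a b) u := fun u hu k hk =>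
    contDiffWithinAt_of_mem_pathSpace hΩ β.2 hu (hk.trans hm)
  have hΩI := hΩ.subset
  obtain ⟨O, hO, hOΩ⟩ := id hΩ
  have hcl : ContDiffOn ℝ ℓ β.1 Ω := β.2.2.of_le (by exact_mod_cast hm)
  have hcomp : ∀ l : Fin n, ContDiffOn ℝ ℓ (fun v => β.1 v l) (O ∩ Icc a b) :=
    contDiffOn_euclidean.1 (hOΩ ▸ hcl)
  have hcont : ∀ l : Fin n, ContinuousOn (fun v => β.1 v l) (Icc a b) := fun l =>
    (EuclideanSpace.proj (𝕜 := ℝ) l).continuous.comp_continuousOn β.2.1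
  have hε' : 0 < ε / (n + 1) := by positivity
  choose P hP0 hPK hPτ using fun l : Fin n => exists_polynomial_near_jets hτ hab hO (hcont l)
    (hcomp l) (fun i => hOΩ.subset (hτΩ i)) hK (hKΩ.trans hOΩ.subset) hε'
  refine ⟨⟨polynomialPath P, (contDiff_polynomialPath P (m := 0)).continuous.continuousOn,
    (contDiff_polynomialPath P).contDiffOn⟩, ⟨fun u hu => ?_, fun k _ hk u hu => ?_⟩,
    ⟨P, fun u _ l => rfl⟩, fun i k hk => ?_⟩
  · exact EuclideanSpace.norm_lt_of_forall_abs_lt hε fun l => hP0 l u hu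
  · refine EuclideanSpace.norm_lt_of_forall_abs_lt hε fun l => ?_
    rw [PiLp.sub_apply, pathDeriv_polynomialPath hab P k (hΩI (hKΩ hu)),
      pathDeriv_apply hab (hΩI (hKΩ hu)) (hcd u (hKΩ hu) k hk)]
    exact hPK l k hk u hu
  · ext l
    rw [pathDeriv_polynomialPath hab P k (hΩI (hτΩ i)),
      pathDeriv_apply hab (hΩI (hτΩ i)) (hcd _ (hτΩ i) k hk)]
    exact hPτ l i k hk

/-- The maximum is attained, so a strict bound leaves a uniform margin. This margin is the radius
used to recentre a basic neighbourhood at another of its points. -/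
theorem IsCompact.eventually_add_le {T : Set ℝ} (hT : IsCompact T) {h : ℝ → ℝ}
    (hh : ContinuousOn h T) {ε : ℝ} (hlt : ∀ u ∈ T, h u < ε) :
    ∀ᶠ η in 𝓝[>] (0 : ℝ), ∀ u ∈ T, h u + η ≤ ε := by
  rcases T.eq_empty_or_nonempty with rfl | hne
  · simp
  · obtain ⟨u₀, hu₀, hmax⟩ := hT.exists_isMaxOn hne hh
    filter_upwards [(eventually_lt_nhds (sub_pos.2 (hlt u₀ hu₀))).filter_mono nhdsWithin_le_nhds]
      with η hη u hu
    linarith [isMaxOn_iff.1 hmax u hu]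

theorem basicNhd_mono {n : ℕ} {a b : ℝ} {Ω : Set ℝ} {m ℓ : ℕ} {β : pathSpace n a b Ω m}
    {K K' : Set ℝ} {ε ε' : ℝ} (hK : K ⊆ K') (hε : ε' ≤ ε) :
    basicNhd ℓ β K' ε' ⊆ basicNhd ℓ β K ε := fun _ h =>
  ⟨fun u hu => (h.1 u hu).trans_le hε, fun k h1 h2 u hu => (h.2 k h1 h2 u (hK hu)).trans_le hε⟩

/-- Every neighbourhood of `β` open in the `C^ℓ_Ω`-topology contains some `U^ℓ_{β,K,ε}`. -/
theorem exists_basicNhd_subset {n : ℕ} {a b : ℝ} (hab : a < b) {Ω : Set ℝ} {m ℓ : ℕ} (hm : ℓ ≤ m)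
    (hΩ : IsOpenInIcc a b Ω) {V : Set (pathSpace n a b Ω m)}
    (hV : IsOpen[pathTopology n a b Ω m ℓ] V) {β : pathSpace n a b Ω m} (hβ : β ∈ V) :
    ∃ (K : Set ℝ) (ε : ℝ), IsCompact K ∧ K ⊆ Ω ∧ 0 < ε ∧ basicNhd ℓ β K ε ⊆ V := by
  induction hV with
  | basic V h =>
    obtain ⟨g, K, ε, hK, hKΩ, hε, rfl⟩ := h
    have h0 : ∀ᶠ η in 𝓝[>] (0 : ℝ), ∀ u ∈ Icc a b, ‖β.1 u - g.1 u‖ + η ≤ ε :=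
      isCompact_Icc.eventually_add_le (β.2.1.sub g.2.1).norm hβ.1
    have hk : ∀ᶠ η in 𝓝[>] (0 : ℝ), ∀ k ∈ Icc 1 ℓ, ∀ u ∈ K,
        ‖pathDeriv a b k β.1 u - pathDeriv a b k g.1 u‖ + η ≤ ε := by
      rw [Filter.eventually_all_finite (finite_Icc 1 ℓ)]
      intro k hk
      refine hK.eventually_add_le (ContinuousOn.mono ?_ hKΩ).norm (hβ.2 k hk.1 hk.2)
      exact (continuousOn_pathDeriv hab hΩ β.2 (hk.2.trans hm)).sub
        (continuousOn_pathDeriv hab hΩ g.2 (hk.2.trans hm))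
    obtain ⟨η, ⟨h0, hk⟩, hη⟩ := ((h0.and hk).and self_mem_nhdsWithin).exists
    refine ⟨K, η, hK, hKΩ, hη, fun f hf => ⟨fun u hu => ?_, fun k h1 h2 u hu => ?_⟩⟩
    · linarith [norm_sub_le_norm_sub_add_norm_sub (f.1 u) (β.1 u) (g.1 u), hf.1 u hu, h0 u hu]
    · linarith [norm_sub_le_norm_sub_add_norm_sub (pathDeriv a b k f.1 u) (pathDeriv a b k β.1 u)
        (pathDeriv a b k g.1 u), hf.2 k h1 h2 u hu, hk k ⟨h1, h2⟩ u hu]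
  | univ => exact ⟨∅, 1, isCompact_empty, empty_subset _, one_pos, subset_univ _⟩
  | inter V₁ V₂ _ _ ih₁ ih₂ =>
    obtain ⟨K₁, ε₁, hK₁, hKΩ₁, hε₁, h₁⟩ := ih₁ hβ.1
    obtain ⟨K₂, ε₂, hK₂, hKΩ₂, hε₂, h₂⟩ := ih₂ hβ.2
    exact ⟨K₁ ∪ K₂, min ε₁ ε₂, hK₁.union hK₂, union_subset hKΩ₁ hKΩ₂, lt_min hε₁ hε₂,
      subset_inter ((basicNhd_mono subset_union_left (min_le_left _ _)).trans h₁)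
        ((basicNhd_mono subset_union_right (min_le_right _ _)).trans h₂)⟩
  | sUnion 𝒱 _ ih =>
    obtain ⟨V, hV, hβV⟩ := hβ
    obtain ⟨K, ε, hK, hKΩ, hε, h⟩ := ih V hV hβV
    exact ⟨K, ε, hK, hKΩ, hε, h.trans (subset_sUnion_of_mem hV)⟩

/-- Near an interior point `τ` of `Ω`, elements of `U^ℓ_{β,K,ε}` with the same jet as `β` at `τ`
differ from `β` by at most `ε |u - τ| ^ ℓ`. -/
theorem norm_sub_le_of_mem_basicNhd {n : ℕ} {a b : ℝ} {Ω : Set ℝ} {m ℓ : ℕ}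
    (hm : ℓ ≤ m) (hΩ : IsOpenInIcc a b Ω) {α β : pathSpace n a b Ω m} {τ δ ε : ℝ} (hδ : 0 < δ)
    (hδΩ : Metric.ball τ δ ⊆ Ω) {K : Set ℝ} (hK : Metric.ball τ δ ⊆ K)
    (hα : α ∈ basicNhd ℓ β K ε)
    (hjet : ∀ k ≤ ℓ, pathDeriv a b k α.1 τ = pathDeriv a b k β.1 τ) :
    ∀ u ∈ Metric.ball τ δ, ‖α.1 u - β.1 u‖ ≤ ε * |u - τ| ^ ℓ := by
  have hI : Metric.ball τ δ ⊆ Icc a b := hδΩ.trans hΩ.subset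
  have hτ := Metric.mem_ball_self (x := τ) hδ
  have hab : a < b := by
    have h1 := hI (show τ - δ / 2 ∈ Metric.ball τ δ by
      rw [Real.ball_eq_Ioo]; constructor <;> linarith)
    have h2 := (hI hτ).2
    linarith [h1.1]
  have hnhds : ∀ u ∈ Metric.ball τ δ, Icc a b ∈ 𝓝 u := fun u hu =>
    Filter.mem_of_superset (Metric.isOpen_ball.mem_nhds hu) hI
  have hcd : ∀ (f : pathSpace n a b Ω m), ∀ u ∈ Metric.ball τ δ, ∀ k ≤ ℓ, ContDiffAt ℝ k f.1 u :=
    fun f u hu k hk => (contDiffWithinAt_of_mem_pathSpace hΩ f.2 (hδΩ hu)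
      (hk.trans hm)).contDiffAt (hnhds u hu)
  have hder : ∀ u ∈ Metric.ball τ δ, ∀ k ≤ ℓ, iteratedDeriv k (α.1 - β.1) u =
      pathDeriv a b k α.1 u - pathDeriv a b k β.1 u := by
    intro u hu k hk
    rw [iteratedDeriv_sub (hcd α u hu k hk) (hcd β u hu k hk), pathDeriv, pathDeriv,
      iteratedDerivWithin_eq_iteratedDeriv (uniqueDiffOn_Icc hab) (hcd α u hu k hk) (hI hu),
      iteratedDerivWithin_eq_iteratedDeriv (uniqueDiffOn_Icc hab) (hcd β u hu k hk) (hI hu)]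
  refine norm_le_mul_abs_pow_of_iteratedDeriv (φ := α.1 - β.1)
    (fun u hu => (hcd α u hu ℓ le_rfl).sub (hcd β u hu ℓ le_rfl)) (fun k hk => ?_) fun u hu => ?_
  · rw [hder τ hτ k hk.le, hjet k hk.le, sub_self]
  · rw [hder u hu ℓ le_rfl]
    -- The derivative conditions of `basicNhd` start at order `1`; for `ℓ = 0` the bound comes from
    -- its uniform part.
    rcases Nat.eq_zero_or_pos ℓ with rfl | hℓ
    · simpa [pathDeriv] using (hα.1 u (hI hu)).le
    · exact (hα.2 ℓ hℓ le_rfl u (hK hu)).le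

/-! ### Subdivision of the interval and gluing of local conditions -/

/-- The points of the line lying in the `k`-th interval of a subdivision, where the first and the
last interval are unbounded. -/
def subdivisionCell {r : ℕ} (t : Fin (r + 2) → ℝ) (k : Fin (r + 1)) : Set ℝ :=
  {u | (k ≠ 0 → t k.castSucc < u) ∧ (k ≠ Fin.last r → u < t k.succ)}

theorem isOpen_subdivisionCell {r : ℕ} (t : Fin (r + 2) → ℝ) (k : Fin (r + 1)) :
    IsOpen (subdivisionCell t k) := by
  have h : ∀ (p : Prop) {U : Set ℝ}, IsOpen U → IsOpen {u | p → u ∈ U} := fun p U hU => by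
    by_cases hp : p <;> simp [hp, hU]
  exact (h _ isOpen_Ioi).inter (h _ isOpen_Iio)

theorem Ioo_subset_subdivisionCell {r : ℕ} (t : Fin (r + 2) → ℝ) (k : Fin (r + 1)) :
    Ioo (t k.castSucc) (t k.succ) ⊆ subdivisionCell t k := fun _ hu =>
  ⟨fun _ => hu.1, fun _ => hu.2⟩

/-- A point in no cell and at no interior node lies to the right of each successive node, hence in
the last cell after all. As the outer cells are unbounded, `a` and `b` need no separate treatment.
-/
theorem exists_mem_subdivisionCell_or_eq {r : ℕ} (t : Fin (r + 2) → ℝ) (u : ℝ) :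
    (∃ k, u ∈ subdivisionCell t k) ∨ ∃ i : Fin r, u = t i.succ.castSucc := by
  by_contra! h
  obtain ⟨h1, h2⟩ := h
  have key : ∀ k : Fin (r + 1), k ≠ 0 → t k.castSucc < u := by
    intro k
    induction k using Fin.induction with
    | zero => exact fun h => absurd rfl h
    | succ i ih =>
      intro _
      by_contra hlt
      refine h1 i.castSucc ⟨ih, fun _ => ?_⟩
      rw [Fin.succ_castSucc]
      exact lt_of_le_of_ne (not_lt.1 hlt) (h2 i)
  exact h1 (Fin.last r) ⟨key _, fun h => absurd rfl h⟩

theorem eq_of_mem_subdivisionCell {r : ℕ} {t : Fin (r + 2) → ℝ} (ht : StrictMono t)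
    {k k' : Fin (r + 1)} {u : ℝ} (hk : u ∈ subdivisionCell t k) (hk' : u ∈ subdivisionCell t k') :
    k = k' := by
  by_contra hne
  wlog h : k < k' generalizing k k'
  · exact this hk' hk (Ne.symm hne) (lt_of_le_of_ne (not_lt.1 h) (Ne.symm hne))
  have h1 := hk'.1 (Fin.ne_zero_of_lt h)
  have h2 := hk.2 (Fin.ne_last_of_lt h)
  have h3 : t k.succ ≤ t k'.castSucc := ht.monotone (by
    rw [Fin.le_def, Fin.val_succ, Fin.val_castSucc]
    exact h)
  linarith

/-- Away from the nodes no derivatives are needed, so `K = ∅` is enough. -/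
theorem exists_basicNhd_eventually_mem {n : ℕ} {a b : ℝ} {Ω : Set ℝ} {m ℓ : ℕ}
    (β : pathSpace n a b Ω m) {W : Set (RSpace n)} (hW : IsOpen W) {u₀ : ℝ} (hu₀ : u₀ ∈ Icc a b)
    (hβ : β.1 u₀ ∈ W) :
    ∃ ε : ℝ, 0 < ε ∧ ∀ᶠ u in 𝓝[Icc a b] u₀, ∀ α ∈ basicNhd ℓ β ∅ ε, α.1 u ∈ W := by
  obtain ⟨ρ, hρ, hρW⟩ := Metric.isOpen_iff.1 hW _ hβ
  refine ⟨ρ / 2, half_pos hρ, ?_⟩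
  filter_upwards [Metric.tendsto_nhds.1 (β.2.1 u₀ hu₀) _ (half_pos hρ), self_mem_nhdsWithin]
    with u hu huI α hα
  have h1 := hα.1 u huI
  rw [← dist_eq_norm] at h1
  refine hρW (Metric.mem_ball.2 ?_)
  linarith [dist_triangle (α.1 u) (β.1 u) (β.1 u₀)]

/-- Near a node `τ` of the subdivision, paths of `U^ℓ_{β,K,ε}` with the jet of `β` at `τ` stay in
the basic open sets which `β` enters to order at most `ℓ` on either side. -/
theorem exists_basicNhd_mem_basicOpenSet {n s : ℕ} {a b : ℝ} {Ω : Set ℝ} {m ℓ : ℕ} (hm : ℓ ≤ m)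
    (hΩ : IsOpenInIcc a b Ω) (β : pathSpace n a b Ω m) {τ : ℝ} (hτ : τ ∈ Ω) (hτI : τ ∈ Ioo a b)
    {f g : Fin s → MvPolynomial (Fin n) ℝ} {A B : Fin s → ℝ} {N P : Fin s → ℕ}
    (hA : ∀ j, 0 < A j) (hB : ∀ j, 0 < B j) (hN : ∀ j, N j ≤ ℓ) (hP : ∀ j, P j ≤ ℓ)
    (hf : ∀ j, HasLowestTerm (fun u => polyVal (f j) (β.1 (τ - u))) (A j) (N j))
    (hg : ∀ j, HasLowestTerm (fun u => polyVal (g j) (β.1 (τ + u))) (B j) (P j)) :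
    ∃ (K : Set ℝ) (ε : ℝ), IsCompact K ∧ K ⊆ Ω ∧ 0 < ε ∧ ∀ᶠ u in 𝓝 τ, ∀ α ∈ basicNhd ℓ β K ε,
      (∀ k ≤ ℓ, pathDeriv a b k α.1 τ = pathDeriv a b k β.1 τ) →
      (u < τ → α.1 u ∈ basicOpenSet f) ∧ (τ < u → α.1 u ∈ basicOpenSet g) := by
  have hcont : ContinuousAt β.1 τ := (β.2.1 τ (Ioo_subset_Icc_self hτI)).continuousAt
    (Icc_mem_nhds hτI.1 hτI.2)
  have hΩτ : Ω ∈ 𝓝 τ := by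
    obtain ⟨O, hO, rfl⟩ := hΩ
    exact Filter.inter_mem (hO.mem_nhds hτ.1) (Icc_mem_nhds hτI.1 hτI.2)
  obtain ⟨δ, hδ, hδΩ⟩ := Metric.nhds_basis_closedBall.mem_iff.1 hΩτ
  have hleft : ∀ᶠ ε in 𝓝[>] (0 : ℝ), ∀ j, ∀ᶠ v in 𝓝[>] (0 : ℝ), ∀ y,
      ‖y - β.1 (τ - v)‖ ≤ ε * v ^ ℓ → 0 < polyVal (f j) y :=
    Filter.eventually_all.2 fun j => eventually_polyVal_pos_of_hasLowestTerm
      (ContinuousAt.comp (g := β.1) (f := fun v => τ - v) (by simpa using hcont) (by fun_prop))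
      (hA j) (hN j) (hf j)
  have hright : ∀ᶠ ε in 𝓝[>] (0 : ℝ), ∀ j, ∀ᶠ v in 𝓝[>] (0 : ℝ), ∀ y,
      ‖y - β.1 (τ + v)‖ ≤ ε * v ^ ℓ → 0 < polyVal (g j) y :=
    Filter.eventually_all.2 fun j => eventually_polyVal_pos_of_hasLowestTerm
      (ContinuousAt.comp (g := β.1) (f := fun v => τ + v) (by simpa using hcont) (by fun_prop))
      (hB j) (hP j) (hg j)
  -- The number `ε` is fixed first; the range `η` of admissible `v` depends on it, while the compact
  -- set `closedBall τ δ` does not.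
  obtain ⟨ε, ⟨hl, hr⟩, hε⟩ := ((hleft.and hright).and self_mem_nhdsWithin).exists
  obtain ⟨η, hη, hηv⟩ := (mem_nhdsGT_iff_exists_Ioo_subset).1
    ((Filter.eventually_all.2 hl).and (Filter.eventually_all.2 hr))
  have hη : 0 < η := hη
  refine ⟨Metric.closedBall τ δ, ε, isCompact_closedBall τ δ, hδΩ, hε, ?_⟩
  filter_upwards [Metric.ball_mem_nhds τ hδ, Metric.ball_mem_nhds τ hη] with u hu1 hu2 α hα hjet
  have hb := norm_sub_le_of_mem_basicNhd hm hΩ hδ (Metric.ball_subset_closedBall.trans hδΩ)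
    Metric.ball_subset_closedBall hα hjet u hu1
  rw [Real.ball_eq_Ioo] at hu2
  refine ⟨fun hu j => ?_, fun hu j => ?_⟩
  · refine (hηv (show τ - u ∈ Ioo 0 η from ⟨by linarith, by linarith [hu2.1]⟩)).1 j _ ?_
    rwa [sub_sub_cancel, ← abs_of_pos (sub_pos.2 hu), abs_sub_comm]
  · refine (hηv (show u - τ ∈ Ioo 0 η from ⟨by linarith, by linarith [hu2.2]⟩)).2 j _ ?_
    rwa [add_sub_cancel, ← abs_of_pos (sub_pos.2 hu)]

/-- The existence of a basic neighbourhood that works over `T` passes to subsets of `T` and to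
finite unions (unite the `K`, take the least `ε`). By compactness it need only be checked near each
point of `[a,b]`, inside a cell or at a node. -/
theorem exists_basicNhd_mapsTo {n r s : ℕ} {S : Fin (r + 1) → Set (RSpace n)}
    (hSopen : ∀ k, IsOpen (S k)) {a b : ℝ} {t : Fin (r + 2) → ℝ} (ht : StrictMono t)
    (hta : t 0 = a) (htb : t (Fin.last (r + 1)) = b) {Ω : Set ℝ} {m ℓ : ℕ} (hm : ℓ ≤ m)
    (hΩ : IsOpenInIcc a b Ω) (htΩ : ∀ i : Fin r, t i.succ.castSucc ∈ Ω) (β : pathSpace n a b Ω m)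
    (hβS : ∀ k, MapsTo β.1 (subdivisionCell t k ∩ Icc a b) (S k))
    {f g : Fin r → Fin s → MvPolynomial (Fin n) ℝ} {A B : Fin r → Fin s → ℝ}
    {N P : Fin r → Fin s → ℕ} (hfS : ∀ i : Fin r, basicOpenSet (f i) ⊆ S i.castSucc)
    (hgS : ∀ i : Fin r, basicOpenSet (g i) ⊆ S i.succ)
    (hA : ∀ i j, 0 < A i j) (hB : ∀ i j, 0 < B i j) (hN : ∀ i j, N i j ≤ ℓ)
    (hP : ∀ i j, P i j ≤ ℓ)
    (hf : ∀ i j, HasLowestTerm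
      (fun u => polyVal (f i j) (β.1 (t i.succ.castSucc - u))) (A i j) (N i j))
    (hg : ∀ i j, HasLowestTerm
      (fun u => polyVal (g i j) (β.1 (t i.succ.castSucc + u))) (B i j) (P i j)) :
    ∃ (K : Set ℝ) (ε : ℝ), IsCompact K ∧ K ⊆ Ω ∧ 0 < ε ∧ ∀ α ∈ basicNhd ℓ β K ε,
      (∀ i : Fin r, ∀ k ≤ ℓ, pathDeriv a b k α.1 (t i.succ.castSucc) =
        pathDeriv a b k β.1 (t i.succ.castSucc)) →
      ∀ k, MapsTo α.1 (subdivisionCell t k ∩ Icc a b) (S k) := by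
  have key : ∃ (K : Set ℝ) (ε : ℝ), IsCompact K ∧ K ⊆ Ω ∧ 0 < ε ∧ ∀ α ∈ basicNhd ℓ β K ε,
      (∀ i : Fin r, ∀ k ≤ ℓ, pathDeriv a b k α.1 (t i.succ.castSucc) =
        pathDeriv a b k β.1 (t i.succ.castSucc)) →
      ∀ u ∈ Icc a b, ∀ k, u ∈ subdivisionCell t k → α.1 u ∈ S k := by
    refine isCompact_Icc.induction_on (p := fun T => ∃ (K : Set ℝ) (ε : ℝ), IsCompact K ∧ K ⊆ Ω ∧
      0 < ε ∧ ∀ α ∈ basicNhd ℓ β K ε,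
      (∀ i : Fin r, ∀ k ≤ ℓ, pathDeriv a b k α.1 (t i.succ.castSucc) =
        pathDeriv a b k β.1 (t i.succ.castSucc)) →
      ∀ u ∈ T, ∀ k, u ∈ subdivisionCell t k → α.1 u ∈ S k) ?_ ?_ ?_ ?_
    · exact ⟨∅, 1, isCompact_empty, empty_subset _, one_pos, by simp⟩
    · rintro T T' hT ⟨K, ε, hK, hKΩ, hε, h⟩
      exact ⟨K, ε, hK, hKΩ, hε, fun α hα hj u hu => h α hα hj u (hT hu)⟩
    · rintro T T' ⟨K, ε, hK, hKΩ, hε, h⟩ ⟨K', ε', hK', hKΩ', hε', h'⟩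
      refine ⟨K ∪ K', min ε ε', hK.union hK', union_subset hKΩ hKΩ', lt_min hε hε', ?_⟩
      rintro α hα hj u (hu | hu)
      · exact h α (basicNhd_mono subset_union_left (min_le_left _ _) hα) hj u hu
      · exact h' α (basicNhd_mono subset_union_right (min_le_right _ _) hα) hj u hu
    · intro u₀ hu₀
      rcases exists_mem_subdivisionCell_or_eq t u₀ with ⟨k, hk⟩ | ⟨i, rfl⟩
      · obtain ⟨ε, hε, h⟩ := exists_basicNhd_eventually_mem (ℓ := ℓ) β (hSopen k) hu₀ (hβS k ⟨hk, hu₀⟩)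
        refine ⟨_, h.and (((isOpen_subdivisionCell t k).eventually_mem hk).filter_mono
          nhdsWithin_le_nhds), ∅, ε, isCompact_empty, empty_subset _, hε, ?_⟩
        rintro α hα - u ⟨hu, huk⟩ k' huk'
        rw [eq_of_mem_subdivisionCell ht huk' huk]
        exact hu α hα
      · have h0 : t i.castSucc.castSucc < t i.succ.castSucc :=
          ht (by simp [Fin.lt_def])
        have h1 : t i.succ.castSucc < t i.succ.succ := ht (by simp [Fin.lt_def])
        have hτI : t i.succ.castSucc ∈ Ioo a b := by
          rw [← hta, ← htb]
          exact ⟨h0.trans_le' (ht.monotone (Fin.zero_le _)),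
            h1.trans_le (ht.monotone (Fin.le_last _))⟩
        obtain ⟨K, ε, hK, hKΩ, hε, h⟩ := exists_basicNhd_mem_basicOpenSet hm hΩ β (htΩ i) hτI
          (hA i) (hB i) (hN i) (hP i) (hf i) (hg i)
        refine ⟨_, (h.and (Ioo_mem_nhds h0 h1)).filter_mono nhdsWithin_le_nhds, K, ε, hK, hKΩ, hε, ?_⟩
        rintro α hα hj u ⟨hu, hu0, hu1⟩ k huk
        obtain ⟨hl, hr⟩ := hu α hα (hj i)
        rcases lt_trichotomy u (t i.succ.castSucc) with hlt | rfl | hlt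
        · rw [eq_of_mem_subdivisionCell ht huk (Ioo_subset_subdivisionCell t i.castSucc
            ⟨hu0, by rwa [Fin.succ_castSucc]⟩)]
          exact hfS i (hl hlt)
        -- A node lies in no cell, since cells are open at interior nodes.
        · exfalso
          rcases lt_or_ge k.castSucc i.succ.castSucc with hki | hki
          · have h2 : t k.succ ≤ t i.succ.castSucc := ht.monotone hki
            have := huk.2 (Fin.ne_last_of_lt (Fin.castSucc_lt_castSucc_iff.1 hki))
            linarith
          · have := huk.1 (Fin.ne_zero_of_lt (lt_of_lt_of_le i.succ_pos
              (Fin.castSucc_le_castSucc_iff.1 hki)))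
            linarith [ht.monotone hki]
        · rw [eq_of_mem_subdivisionCell ht huk (Ioo_subset_subdivisionCell t i.succ ⟨hlt, hu1⟩)]
          exact hgS i (hr hlt)
  obtain ⟨K, ε, hK, hKΩ, hε, h⟩ := key
  exact ⟨K, ε, hK, hKΩ, hε, fun α hα hj k u hu => h α hα hj u hu.2 k hu.1⟩

theorem mainTheorem7 {n r s : ℕ} (S : Fin (r + 1) → Set (RSpace n)) (x : Fin r → RSpace n)
    (hSconn : ∀ k, IsConnected (S k)) (hSopen : ∀ k, IsOpen (S k))
    (hSalg : ∀ k, IsSemialgebraic (S k))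
    (hx : ∀ i : Fin r, x i ∈ closure (S i.castSucc) ∩ closure (S i.succ))
    (a b : ℝ) (hab : a < b) (t : Fin (r + 2) → ℝ) (ht : StrictMono t)
    (hta : t 0 = a) (htb : t (Fin.last (r + 1)) = b)
    (β : ℝ → RSpace n) (hβ : ContinuousOn β (Icc a b))
    (hβimg : MapsTo β (Icc a b) ((⋃ k, S k) ∪ range x))
    -- (i)
    (hβS : ∀ k : Fin (r + 1), MapsTo β (Ioo (t k.castSucc) (t k.succ)) (S k))
    (hβa : β a ∈ S 0) (hβb : β b ∈ S (Fin.last r))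
    -- (ii)
    (hβx : ∀ i : Fin r, β (t i.succ.castSucc) = x i)
    (hβan : ∀ i : Fin r, AnalyticAt ℝ β (t i.succ.castSucc))
    -- (iii)
    (f : Fin r → Fin s → MvPolynomial (Fin n) ℝ)
    (hfS : ∀ i : Fin r, basicOpenSet (f i) ⊆ S i.castSucc)
    (hfx : ∀ i : Fin r, x i ∈ closure (basicOpenSet (f i)))
    (A : Fin r → Fin s → ℝ) (N : Fin r → Fin s → ℕ) (hA : ∀ i j, 0 < A i j)
    (hfβ : ∀ i j, HasLowestTerm
      (fun u => polyVal (f i j) (β (t i.succ.castSucc - u))) (A i j) (N i j))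
    -- (iv)
    (g : Fin r → Fin s → MvPolynomial (Fin n) ℝ)
    (hgS : ∀ i : Fin r, basicOpenSet (g i) ⊆ S i.succ)
    (hgx : ∀ i : Fin r, x i ∈ closure (basicOpenSet (g i)))
    (B : Fin r → Fin s → ℝ) (P : Fin r → Fin s → ℕ) (hB : ∀ i j, 0 < B i j)
    (hgβ : ∀ i j, HasLowestTerm
      (fun u => polyVal (g i j) (β (t i.succ.castSucc + u))) (B i j) (P i j))
    (ℓ : ℕ)
    (hℓ : ℓ = Finset.univ.sup fun ij : Fin r × Fin s => max (N ij.1 ij.2) (P ij.1 ij.2))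
    (Ω : Set ℝ) (hΩ : IsOpenInIcc a b Ω) (htΩ : ∀ i : Fin r, t i.succ.castSucc ∈ Ω)
    (hβΩ : AnalyticOn ℝ β Ω) :
    -- (1)
    (∃ U : Set (pathSpace n a b Ω (ℓ + 4)),
      IsOpen[pathTopology n a b Ω (ℓ + 4) ℓ] U ∧
      ⟨β, mem_pathSpace_of_analyticOn hβ hab hΩ hβΩ (ℓ + 4)⟩ ∈ U ∧
      ∀ α ∈ U,
        (∀ i : Fin r, ∀ m ≤ ℓ, pathDeriv a b m α.1 (t i.succ.castSucc) =
          pathDeriv a b m β (t i.succ.castSucc)) →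
        ∀ k : Fin (r + 1), MapsTo α.1 (Ioo (t k.castSucc) (t k.succ)) (S k)) ∧
    -- (2)
    (∀ V : Set (pathSpace n a b Ω (ℓ + 4)),
      IsOpen[pathTopology n a b Ω (ℓ + 4) ℓ] V →
      ⟨β, mem_pathSpace_of_analyticOn hβ hab hΩ hβΩ (ℓ + 4)⟩ ∈ V →
      ∃ α ∈ V, IsPolynomialPath a b α.1 ∧
        MapsTo α.1 (Icc a b) ((⋃ k, S k) ∪ range x) ∧
        (∀ i : Fin r, α.1 (t i.succ.castSucc) = x i) ∧
        (∀ i : Fin r, ∀ m ≤ ℓ, pathDeriv a b m α.1 (t i.succ.castSucc) =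
          pathDeriv a b m β (t i.succ.castSucc)) ∧
        ∀ k : Fin (r + 1), MapsTo α.1 (Ioo (t k.castSucc) (t k.succ)) (S k)) := by
  have hle : ∀ i j, N i j ≤ ℓ ∧ P i j ≤ ℓ := by
    intro i j
    rw [← max_le_iff, hℓ]
    exact Finset.le_sup (f := fun ij : Fin r × Fin s => max (N ij.1 ij.2) (P ij.1 ij.2))
      (Finset.mem_univ (i, j))
  have hm : ℓ ≤ ℓ + 4 := Nat.le_add_right _ _
  -- Besides the open interval, such a set contains only `a` (first cell) and `b` (last cell),
  -- covered by the endpoint assumptions in (i).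
  have hcell : ∀ k, MapsTo β (subdivisionCell t k ∩ Icc a b) (S k) := by
    rintro k u ⟨hu, hua, hub⟩
    by_cases h0 : k = 0 ∧ u = a
    · obtain ⟨rfl, rfl⟩ := h0
      exact hβa
    by_cases h1 : k = Fin.last r ∧ u = b
    · obtain ⟨rfl, rfl⟩ := h1
      exact hβb
    refine hβS k ⟨?_, ?_⟩
    · by_cases hk : k = 0
      · rw [hk, Fin.castSucc_zero, hta]
        exact lt_of_le_of_ne hua fun h => h0 ⟨hk, h.symm⟩
      · exact hu.1 hk
    · by_cases hk : k = Fin.last r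
      · rw [hk, Fin.succ_last, htb]
        exact lt_of_le_of_ne hub fun h => h1 ⟨hk, h⟩
      · exact hu.2 hk
  have hIoo : ∀ k : Fin (r + 1), Ioo (t k.castSucc) (t k.succ) ⊆ subdivisionCell t k ∩ Icc a b := by
    intro k u hu
    refine ⟨Ioo_subset_subdivisionCell t k hu, ?_, ?_⟩
    · rw [← hta]
      exact (ht.monotone (Fin.zero_le _)).trans hu.1.le
    · rw [← htb]
      exact hu.2.le.trans (ht.monotone (Fin.le_last _))
  obtain ⟨K, ε, hK, hKΩ, hε, hmain⟩ := exists_basicNhd_mapsTo hSopen ht hta htb hm hΩ htΩ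
    ⟨β, mem_pathSpace_of_analyticOn hβ hab hΩ hβΩ (ℓ + 4)⟩ hcell hfS hgS hA hB
    (fun i j => (hle i j).1) (fun i j => (hle i j).2) hfβ hgβ
  refine ⟨⟨basicNhd ℓ ⟨β, mem_pathSpace_of_analyticOn hβ hab hΩ hβΩ (ℓ + 4)⟩ K ε,
    TopologicalSpace.isOpen_generateFrom_of_mem ⟨_, K, ε, hK, hKΩ, hε, rfl⟩,
    ⟨fun u _ => by simpa using hε, fun k _ _ u _ => by simpa using hε⟩,
    fun α hα hj k => (hmain α hα hj k).mono_left (hIoo k)⟩, fun V hV hβV => ?_⟩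
  obtain ⟨K', ε', hK', hKΩ', hε', hsub⟩ := exists_basicNhd_subset hab hm hΩ hV hβV
  have hinj : Function.Injective fun i : Fin r => t i.succ.castSucc := fun i j h =>
    Fin.succ_injective _ (Fin.castSucc_injective _ (ht.injective h))
  -- With `K ∪ K'` and `min ε ε'` the path lies both in the neighbourhood from (1), which places it
  -- in the `S k`, and in `V`.
  obtain ⟨α, hα, hpoly, hj⟩ := exists_polynomialPath_near_jets hinj hab hm hΩ htΩ
    ⟨β, mem_pathSpace_of_analyticOn hβ hab hΩ hβΩ (ℓ + 4)⟩ (hK.union hK')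
    (union_subset hKΩ hKΩ') (lt_min hε hε')
  have hS := hmain α (basicNhd_mono subset_union_left (min_le_left _ _) hα) hj
  have hval : ∀ i : Fin r, α.1 (t i.succ.castSucc) = x i := by
    intro i
    rw [← hβx i]
    simpa [pathDeriv] using hj i 0 (Nat.zero_le _)
  refine ⟨α, hsub (basicNhd_mono subset_union_right (min_le_right _ _) hα), hpoly, ?_, hval, hj,
    fun k => (hS k).mono_left (hIoo k)⟩
  intro u hu
  rcases exists_mem_subdivisionCell_or_eq t u with ⟨k, hk⟩ | ⟨i, rfl⟩
  · exact Or.inl (mem_iUnion.2 ⟨k, hS k ⟨hk, hu⟩⟩)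
  · exact Or.inr ⟨i, (hval i).symm⟩
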